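/- Let $G$ be a finite, simple, undirected, connected graph with $n\ge 2$ vertices and $m$ edges. Let $A(G)$ be its adjacency matrix, $D(G)$ its diagonal degree matrix, $L(G)=D(G)-A(G)$ its Laplacian, and, for real $\alpha$ with $\tfrac12\le\alpha<1$, let $A_\alpha(G)=\alpha D(G)+(1-\alpha)A(G)$. Denote the eigenvalues (with multiplicity) of $A(G)$, $L(G)$, $A_\alpha(G)$ by $\gamma_i$, $\mu_i$, $\rho_i$ ($1\le i\le n$), respectively, and put $$\mathfrak{E}(G)=\sum_{i=1}^n|\gamma_i|,\qquad E_L(G)=\sum_{i=1}^n\Big|\mu_i-\frac{2m}{n}\Big|,\qquad E_{A_\alpha}(G)=\sum_{i=1}^n\Big|\rho_i-\frac{2\alpha m}{n}\Big|.$$ Let $\zeta$ be the rank of $A(G)$ over $\mathbb{R}$. Then $$E_{A_\alpha}(G)+\alpha E_L(G)\ \ge\ 2\,\mathfrak{E}(G)-\frac{4\alpha m\zeta}{n}.$$ Equality holds if and only if $\alpha=\tfrac12$, $n$ is even, and $G$ is isomorphic to the complete bipartite graph $K_{\frac n2,\frac n2}$. -/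

import Mathlib

noncomputable section

namespace GraphEnergy

theorem isHermitian_adjMatrix {V : Type*} (G : SimpleGraph V) [DecidableRel G.Adj] :
    (G.adjMatrix ℝ).IsHermitian :=
  Matrix.isHermitian_iff_isSymm.mpr (G.isSymm_adjMatrix)

variable {V : Type*} [Fintype V] [DecidableEq V] (G : SimpleGraph V) [DecidableRel G.Adj]

/-- The matrix `A_α(G) = α D(G) + (1 - α) A(G)`. -/
def aAlphaMatrix (α : ℝ) : Matrix V V ℝ :=
  α • G.degMatrix ℝ + (1 - α) • G.adjMatrix ℝ

theorem isHermitian_lapMatrix : (G.lapMatrix ℝ).IsHermitian :=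
  Matrix.isHermitian_iff_isSymm.mpr (G.isSymm_lapMatrix (R := ℝ))

theorem isHermitian_aAlphaMatrix (α : ℝ) : (aAlphaMatrix G α).IsHermitian :=
  Matrix.isHermitian_iff_isSymm.mpr
    (((G.isSymm_degMatrix (R := ℝ)).smul α).add ((G.isSymm_adjMatrix).smul (1 - α)))

/-- The energy `∑ |γᵢ|`, with `γᵢ` the eigenvalues of the adjacency matrix, counted with
multiplicity. -/
def adjEnergy : ℝ :=
  ∑ i, |(isHermitian_adjMatrix G).eigenvalues i|

/-- The Laplacian energy `∑ |μᵢ - 2m/n|`, with `μᵢ` the eigenvalues of the Laplacian matrix,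
counted with multiplicity. -/
def lapEnergy : ℝ :=
  ∑ i, |(isHermitian_lapMatrix G).eigenvalues i
    - 2 * (G.edgeFinset.card : ℝ) / (Fintype.card V : ℝ)|

/-- The `A_α`-energy `∑ |ρᵢ - 2αm/n|`, with `ρᵢ` the eigenvalues of `A_α(G)`, counted with
multiplicity. -/
def aAlphaEnergy (α : ℝ) : ℝ :=
  ∑ i, |(isHermitian_aAlphaMatrix G α).eigenvalues i
    - 2 * α * (G.edgeFinset.card : ℝ) / (Fintype.card V : ℝ)|

end GraphEnergy

end

/-!
For an orthonormal family `v` and a Hermitian matrix `M` with eigenvalue mean `c`, the sums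
`2 ∑ (⟨v_j, M v_j⟩ - c)` are at most `∑ |λ_k - c|` (Ky Fan). Apply this to `A_α` on the eigenvectors
of the adjacency matrix `A` with positive eigenvalue, and to `L` on those with negative eigenvalue.
Since `A_α = A + αL`, the first estimate plus `α` times the second is the claimed inequality, up to
multiples of the terms `⟨x, L x⟩` for the positive eigenvectors and `⟨x, A_α x⟩` for the negative
ones. These are nonnegative: `L` and, for `α ≥ 1/2`, also `A_α` are positive semidefinite.

In case of equality all these terms vanish. Then a positive eigenvector is constant on every edge,
which makes `G` regular, and a negative one changes sign along every edge; if `α > 1/2`, it would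
also be constant on every edge, hence zero. So all eigenvectors with nonzero eigenvalue agree at
vertices joined by a walk of length two. Such vertices have the same neighbors, because `A` is
recovered from these eigenvectors, and a connected graph with this property is complete bipartite.

Conversely, in `K_{d,d}` one has `A³ = d²A`, so the energy of `A` is `d` times its rank, and by
regularity the other two energies are multiples of it.
-/

namespace GraphEnergy

open Matrix

section Spectral

variable {𝕜 n ι : Type*} [RCLike 𝕜] [Fintype n] [DecidableEq n] {M : Matrix n n 𝕜}

theorem re_dotProduct_mulVec_eq_sum_eigenvalues (hM : M.IsHermitian) (v : EuclideanSpace 𝕜 n) :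
    RCLike.re (star v.ofLp ⬝ᵥ M *ᵥ v.ofLp)
      = ∑ k, hM.eigenvalues k * ‖inner 𝕜 (hM.eigenvectorBasis k) v‖ ^ 2 := by
  set u := hM.eigenvectorBasis
  have heigen (k : n) : M.toEuclideanLin (u k) = (hM.eigenvalues k : 𝕜) • u k := by
    ext i
    simpa [RCLike.real_smul_eq_coe_mul] using congrFun (hM.mulVec_eigenvectorBasis k) i
  have hinner (k : n) :
      inner 𝕜 (u k) (M.toEuclideanLin v) = hM.eigenvalues k * inner 𝕜 (u k) v := by
    rw [← isSymmetric_toEuclideanLin_iff.mpr hM, heigen, inner_smul_left, RCLike.conj_ofReal]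
  have hterm (k : n) : inner 𝕜 v (u k) * inner 𝕜 (u k) (M.toEuclideanLin v)
      = ((hM.eigenvalues k * ‖inner 𝕜 (u k) v‖ ^ 2 : ℝ) : 𝕜) := by
    rw [hinner, mul_left_comm, ← inner_conj_symm v, RCLike.conj_mul]
    push_cast
    rfl
  have hquad : star v.ofLp ⬝ᵥ M *ᵥ v.ofLp = inner 𝕜 v (M.toEuclideanLin v) := by
    rw [EuclideanSpace.inner_eq_star_dotProduct, dotProduct_comm]; rfl
  rw [hquad, ← u.sum_inner_mul_inner, map_sum]
  simp_rw [hterm, RCLike.ofReal_re]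

theorem sum_re_dotProduct_mulVec_sub_le (hM : M.IsHermitian) {v : ι → EuclideanSpace 𝕜 n}
    (hv : Orthonormal 𝕜 v) (s : Finset ι) (c : ℝ) :
    ∑ j ∈ s, (RCLike.re (star (v j).ofLp ⬝ᵥ M *ᵥ (v j).ofLp) - c)
      ≤ ∑ k, (hM.eigenvalues k - c)⁺ := by
  have hparseval (j : ι) : ∑ k, ‖inner 𝕜 (hM.eigenvectorBasis k) (v j)‖ ^ 2 = 1 := by
    rw [OrthonormalBasis.sum_sq_norm_inner_right, hv.1 j, one_pow]
  have hbessel (k : n) : ∑ j ∈ s, ‖inner 𝕜 (hM.eigenvectorBasis k) (v j)‖ ^ 2 ≤ 1 := by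
    simpa [norm_inner_symm] using hv.sum_inner_products_le (hM.eigenvectorBasis k) (s := s)
  calc ∑ j ∈ s, (RCLike.re (star (v j).ofLp ⬝ᵥ M *ᵥ (v j).ofLp) - c)
      = ∑ j ∈ s, ∑ k, (hM.eigenvalues k - c) * ‖inner 𝕜 (hM.eigenvectorBasis k) (v j)‖ ^ 2 := by
        refine Finset.sum_congr rfl fun j _ => ?_
        simp_rw [sub_mul, Finset.sum_sub_distrib, ← Finset.mul_sum, hparseval, mul_one,
          re_dotProduct_mulVec_eq_sum_eigenvalues hM]
    _ = ∑ k, (hM.eigenvalues k - c) * ∑ j ∈ s, ‖inner 𝕜 (hM.eigenvectorBasis k) (v j)‖ ^ 2 := by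
        rw [Finset.sum_comm]; simp_rw [Finset.mul_sum]
    _ ≤ ∑ k, (hM.eigenvalues k - c)⁺ := by
        gcongr with k
        exact (mul_le_mul_of_nonneg_right (le_posPart _) (by positivity)).trans
          (mul_le_of_le_one_right (posPart_nonneg _) (hbessel k))

theorem two_mul_sum_re_dotProduct_mulVec_sub_le_sum_abs (hM : M.IsHermitian)
    {v : ι → EuclideanSpace 𝕜 n} (hv : Orthonormal 𝕜 v) (s : Finset ι) {c : ℝ}
    (hc : M.trace = Fintype.card n * c) :
    2 * ∑ j ∈ s, (RCLike.re (star (v j).ofLp ⬝ᵥ M *ᵥ (v j).ofLp) - c)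
      ≤ ∑ k, |hM.eigenvalues k - c| := by
  have hsum : ∑ k, (hM.eigenvalues k - c) = 0 := by
    rw [Finset.sum_sub_distrib, Finset.sum_const, Finset.card_univ, nsmul_eq_mul, sub_eq_zero,
      ← RCLike.ofReal_inj (K := 𝕜)]
    push_cast
    rw [← hM.trace_eq_sum_eigenvalues, hc]
  calc _ ≤ 2 * ∑ k, (hM.eigenvalues k - c)⁺ := by
        gcongr; exact sum_re_dotProduct_mulVec_sub_le hM hv s c
    _ = ∑ k, (|hM.eigenvalues k - c| + (hM.eigenvalues k - c)) := by
        simp_rw [Finset.mul_sum, abs_add_eq_two_nsmul_posPart, nsmul_eq_mul, Nat.cast_ofNat]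
    _ = ∑ k, |hM.eigenvalues k - c| := by rw [Finset.sum_add_distrib, hsum, add_zero]

theorem apply_eq_sum_eigenvalues (hM : M.IsHermitian) (i j : n) :
    M i j = ∑ k, hM.eigenvalues k * hM.eigenvectorBasis k i * star (hM.eigenvectorBasis k j) := by
  conv_lhs => rw [hM.spectral_theorem]
  simp [Unitary.conjStarAlgAut_apply, mul_apply, diagonal_apply, mul_comm, star_apply]

theorem row_eq_row_of_eigenvector_apply_eq (hM : M.IsHermitian) {i l : n}
    (h : ∀ k, hM.eigenvalues k ≠ 0 → hM.eigenvectorBasis k i = hM.eigenvectorBasis k l) :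
    M i = M l := by
  ext j
  rw [apply_eq_sum_eigenvalues hM, apply_eq_sum_eigenvalues hM]
  refine Finset.sum_congr rfl fun k _ => ?_
  by_cases hk : hM.eigenvalues k = 0
  · simp [hk]
  · rw [h k hk]

theorem sum_eigenvalues_cfc (hM : M.IsHermitian) (g : ℝ → ℝ) (hN : (cfc g M).IsHermitian)
    (f : ℝ → ℝ) : ∑ k, f (hN.eigenvalues k) = ∑ k, f (g (hM.eigenvalues k)) := by
  have hroots : (cfc g M).charpoly.roots
      = Finset.univ.val.map fun k => (g (hM.eigenvalues k) : 𝕜) := by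
    rw [hM.charpoly_cfc_eq]
    simpa using! Polynomial.roots_multiset_prod_X_sub_C
      (Finset.univ.val.map fun k => (g (hM.eigenvalues k) : 𝕜))
  rw [hN.roots_charpoly_eq_eigenvalues] at hroots
  simpa using congrArg (fun r => (r.map (f ∘ RCLike.re)).sum) hroots

theorem abs_eigenvalues_eq_of_pow_three_eq_smul (hM : M.IsHermitian) {t : ℝ} (ht : 0 ≤ t)
    (hcube : M ^ 3 = t ^ 2 • M) {k : n} (hk : hM.eigenvalues k ≠ 0) :
    |hM.eigenvalues k| = t := by
  have hne : (hM.eigenvectorBasis k).ofLp ≠ 0 := by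
    simpa using hM.eigenvectorBasis.orthonormal.ne_zero k
  have hpow : hM.eigenvalues k ^ 2 * hM.eigenvalues k = t ^ 2 * hM.eigenvalues k := by
    have h := congrArg (· *ᵥ (hM.eigenvectorBasis k).ofLp) hcube
    simp only [pow_succ, pow_zero, one_mul, ← mulVec_mulVec, smul_mulVec,
      hM.mulVec_eigenvectorBasis, mulVec_smul, smul_smul] at h
    linarith [smul_left_injective ℝ hne h]
  rw [← abs_of_nonneg ht, ← sq_eq_sq_iff_abs_eq_abs]
  exact mul_right_cancel₀ hk hpow

theorem sum_abs_eigenvalues_eq_mul_rank (hM : M.IsHermitian) {t : ℝ} (ht : 0 ≤ t)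
    (hcube : M ^ 3 = t ^ 2 • M) : ∑ k, |hM.eigenvalues k| = t * M.rank := by
  rw [hM.rank_eq_card_non_zero_eigs, Fintype.card_subtype, mul_comm, ← nsmul_eq_mul,
    ← Finset.sum_const, Finset.sum_filter]
  refine Finset.sum_congr rfl fun k _ => ?_
  split_ifs with hk
  · exact abs_eigenvalues_eq_of_pow_three_eq_smul hM ht hcube hk
  · simpa using hk

theorem rank_eq_card_pos_add_card_neg (hM : M.IsHermitian) :
    M.rank = Finset.card {k | 0 < hM.eigenvalues k} + Finset.card {k | hM.eigenvalues k < 0} := by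
  rw [hM.rank_eq_card_non_zero_eigs, Fintype.card_subtype, ← Finset.card_union_of_disjoint
    (Finset.disjoint_filter.mpr fun k _ h => h.not_gt), ← Finset.filter_or]
  simp_rw [ne_iff_gt_or_lt]

theorem sum_eigenvalues_eq_zero (hM : M.IsHermitian) (htr : M.trace = 0) :
    ∑ k, hM.eigenvalues k = 0 := by
  rw [hM.trace_eq_sum_eigenvalues] at htr
  exact_mod_cast htr

theorem exists_eigenvalues_pos (hM : M.IsHermitian) (htr : M.trace = 0) (hne : M ≠ 0) :
    ∃ k, 0 < hM.eigenvalues k := by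
  obtain ⟨k, hk⟩ := Function.ne_iff.mp (hM.eigenvalues_eq_zero_iff.not.mpr hne)
  simpa using Finset.exists_pos_of_sum_zero_of_exists_nonzero _ (sum_eigenvalues_eq_zero hM htr)
    ⟨k, Finset.mem_univ k, hk⟩

theorem exists_eigenvalues_neg (hM : M.IsHermitian) (htr : M.trace = 0) (hne : M ≠ 0) :
    ∃ k, hM.eigenvalues k < 0 := by
  obtain ⟨k, hk⟩ := exists_eigenvalues_pos hM htr hne
  by_contra! hnonneg
  exact hk.ne' ((Finset.sum_eq_zero_iff_of_nonneg fun j _ => hnonneg j).mp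
    (sum_eigenvalues_eq_zero hM htr) k (Finset.mem_univ k))

theorem sum_abs_eigenvalues_sub_of_eq_smul_one_add_smul (hM : M.IsHermitian)
    {N : Matrix n n 𝕜} (hN : N.IsHermitian) {a b : ℝ} (h : N = a • 1 + b • M) :
    ∑ k, |hN.eigenvalues k - a| = |b| * ∑ k, |hM.eigenvalues k| := by
  have hcfc : N = cfc (fun x => a + b * x) M := by
    have hsa : IsSelfAdjoint M := hM
    rw [h, cfc_const_add a (b * ·) M, cfc_const_mul_id b M, Algebra.algebraMap_eq_smul_one]
  subst hcfc
  rw [sum_eigenvalues_cfc hM _ hN (|· - a|), Finset.mul_sum]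
  simp only [add_sub_cancel_left, abs_mul]

end Spectral

section QuadraticForm

variable {V : Type*} [Fintype V] [DecidableEq V] (G : SimpleGraph V) [DecidableRel G.Adj]

section OrderedField

variable {R : Type*} [Field R] [LinearOrder R] [IsStrictOrderedRing R]

theorem dotProduct_lapMatrix_mulVec_eq_zero_iff {x : V → R} :
    x ⬝ᵥ G.lapMatrix R *ᵥ x = 0 ↔ ∀ i j, G.Adj i j → x i = x j := by
  rw [← toLinearMap₂'_apply', SimpleGraph.lapMatrix_toLinearMap₂'_apply'_eq_zero_iff_forall_adj]

theorem dotProduct_degMatrix_add_adjMatrix_mulVec (x : V → R) :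
    x ⬝ᵥ (G.degMatrix R + G.adjMatrix R) *ᵥ x
      = (∑ i, ∑ j, if G.Adj i j then (x i + x j) ^ 2 else 0) / 2 := by
  have hdeg : ∑ i, ∑ j, (if G.Adj i j then x i ^ 2 else 0) = x ⬝ᵥ G.degMatrix R *ᵥ x := by
    simp_rw [G.dotProduct_mulVec_degMatrix, G.degree_eq_sum_if_adj, Finset.sum_mul, ite_mul,
      one_mul, zero_mul, sq]
  have hdeg' : ∑ i, ∑ j, (if G.Adj i j then x j ^ 2 else 0) = x ⬝ᵥ G.degMatrix R *ᵥ x := by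
    rw [← hdeg, Finset.sum_comm]
    simp_rw [G.adj_comm]
  have hsq (i j : V) : (if G.Adj i j then (x i + x j) ^ 2 else 0)
      = (if G.Adj i j then x i ^ 2 else 0) + (if G.Adj i j then x j ^ 2 else 0)
        + 2 * if G.Adj i j then x i * x j else 0 := by
    split_ifs <;> ring
  simp_rw [hsq, Finset.sum_add_distrib, ← Finset.mul_sum, hdeg, hdeg', add_mulVec, dotProduct_add,
    G.dotProduct_mulVec_adjMatrix]
  ring

theorem dotProduct_degMatrix_add_adjMatrix_mulVec_nonneg (x : V → R) :
    0 ≤ x ⬝ᵥ (G.degMatrix R + G.adjMatrix R) *ᵥ x := by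
  rw [dotProduct_degMatrix_add_adjMatrix_mulVec]
  positivity

theorem dotProduct_degMatrix_add_adjMatrix_mulVec_eq_zero_iff {x : V → R} :
    x ⬝ᵥ (G.degMatrix R + G.adjMatrix R) *ᵥ x = 0 ↔ ∀ i j, G.Adj i j → x i = -x j := by
  simp (disch := intros; positivity) [dotProduct_degMatrix_add_adjMatrix_mulVec,
    Finset.sum_eq_zero_iff_of_nonneg, add_eq_zero_iff_eq_neg]

end OrderedField

theorem aAlphaMatrix_eq_adjMatrix_add_smul_lapMatrix (α : ℝ) :
    aAlphaMatrix G α = G.adjMatrix ℝ + α • G.lapMatrix ℝ := by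
  rw [aAlphaMatrix, SimpleGraph.lapMatrix]
  module

theorem aAlphaMatrix_eq_smul_add_smul_lapMatrix (α : ℝ) :
    aAlphaMatrix G α
      = (1 / 2 : ℝ) • (G.degMatrix ℝ + G.adjMatrix ℝ) + (α - 1 / 2) • G.lapMatrix ℝ := by
  rw [aAlphaMatrix, SimpleGraph.lapMatrix]
  module

variable {G}

theorem dotProduct_lapMatrix_mulVec_nonneg (x : V → ℝ) : 0 ≤ x ⬝ᵥ G.lapMatrix ℝ *ᵥ x :=
  (G.posSemidef_lapMatrix ℝ).dotProduct_mulVec_nonneg x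

theorem dotProduct_aAlphaMatrix_mulVec_nonneg {α : ℝ} (hα : 1 / 2 ≤ α) (x : V → ℝ) :
    0 ≤ x ⬝ᵥ aAlphaMatrix G α *ᵥ x := by
  rw [aAlphaMatrix_eq_smul_add_smul_lapMatrix, add_mulVec, smul_mulVec, smul_mulVec, dotProduct_add,
    dotProduct_smul, dotProduct_smul]
  exact add_nonneg
    (smul_nonneg (by norm_num) (dotProduct_degMatrix_add_adjMatrix_mulVec_nonneg G x))
    (smul_nonneg (sub_nonneg.mpr hα) (dotProduct_lapMatrix_mulVec_nonneg x))

theorem dotProduct_aAlphaMatrix_mulVec_eq_zero_iff {α : ℝ} (hα : 1 / 2 ≤ α) {x : V → ℝ} :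
    x ⬝ᵥ aAlphaMatrix G α *ᵥ x = 0 ↔
      (∀ i j, G.Adj i j → x i = -x j) ∧ (α = 1 / 2 ∨ ∀ i j, G.Adj i j → x i = x j) := by
  rw [aAlphaMatrix_eq_smul_add_smul_lapMatrix, add_mulVec, smul_mulVec, smul_mulVec, dotProduct_add,
    dotProduct_smul, dotProduct_smul, add_eq_zero_iff_of_nonneg
      (smul_nonneg (by norm_num) (dotProduct_degMatrix_add_adjMatrix_mulVec_nonneg G x))
      (smul_nonneg (sub_nonneg.mpr hα) (dotProduct_lapMatrix_mulVec_nonneg x)),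
    smul_eq_zero, smul_eq_zero, dotProduct_lapMatrix_mulVec_eq_zero_iff,
    dotProduct_degMatrix_add_adjMatrix_mulVec_eq_zero_iff, sub_eq_zero,
    or_iff_right (by norm_num : (1 / 2 : ℝ) ≠ 0)]

end QuadraticForm

section LowerBound

variable {V ι : Type*} [Fintype V] (G : SimpleGraph V) [DecidableRel G.Adj]

theorem card_mul_two_mul_card_edgeFinset_div_card :
    (Fintype.card V : ℝ) * (2 * (G.edgeFinset.card : ℝ) / (Fintype.card V : ℝ))
      = 2 * (G.edgeFinset.card : ℝ) := by
  refine mul_div_cancel_of_imp' fun h => ?_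
  have : IsEmpty V := Fintype.card_eq_zero_iff.mp (by exact_mod_cast h)
  simpa using Subsingleton.elim G ⊥

variable [DecidableEq V]

theorem trace_degMatrix {R : Type*} [NonAssocSemiring R] :
    (G.degMatrix R).trace = 2 * (G.edgeFinset.card : R) := by
  rw [SimpleGraph.degMatrix, trace_diagonal]
  exact_mod_cast congrArg (Nat.cast (R := R)) G.sum_degrees_eq_twice_card_edges

theorem two_mul_sum_le_lapEnergy {v : ι → EuclideanSpace ℝ V} (hv : Orthonormal ℝ v)
    (s : Finset ι) :
    2 * ∑ j ∈ s, ((v j).ofLp ⬝ᵥ G.lapMatrix ℝ *ᵥ (v j).ofLp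
      - 2 * (G.edgeFinset.card : ℝ) / (Fintype.card V : ℝ)) ≤ lapEnergy G := by
  refine two_mul_sum_re_dotProduct_mulVec_sub_le_sum_abs (isHermitian_lapMatrix G) hv s ?_
  rw [SimpleGraph.lapMatrix, trace_sub, trace_degMatrix, SimpleGraph.trace_adjMatrix, sub_zero]
  exact (card_mul_two_mul_card_edgeFinset_div_card G).symm

theorem two_mul_sum_le_aAlphaEnergy (α : ℝ) {v : ι → EuclideanSpace ℝ V} (hv : Orthonormal ℝ v)
    (s : Finset ι) :
    2 * ∑ j ∈ s, ((v j).ofLp ⬝ᵥ aAlphaMatrix G α *ᵥ (v j).ofLp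
      - 2 * α * (G.edgeFinset.card : ℝ) / (Fintype.card V : ℝ)) ≤ aAlphaEnergy G α := by
  refine two_mul_sum_re_dotProduct_mulVec_sub_le_sum_abs (isHermitian_aAlphaMatrix G α) hv s ?_
  rw [aAlphaMatrix, trace_add, trace_smul, trace_smul, trace_degMatrix,
    SimpleGraph.trace_adjMatrix, smul_zero, add_zero, smul_eq_mul,
    ← card_mul_two_mul_card_edgeFinset_div_card]
  simp only [RCLike.ofReal_real_eq_id, id]
  ring

/-- The orthonormal eigenvectors of the adjacency matrix, as functions on the vertices. They are
indexed by the vertices because Mathlib indexes the eigenvalues of a matrix by its rows. -/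
noncomputable def adjEigenvector (k : V) : V → ℝ :=
  ((isHermitian_adjMatrix G).eigenvectorBasis k).ofLp

/-- What the lower bound on the energies gives away by the positivity of quadratic forms: the forms
of `L` on the positive and of `A_α` on the negative eigenvectors of the adjacency matrix, with the
weights they carry in the sum of the two Ky Fan estimates. -/
noncomputable def energyGap (α : ℝ) : ℝ :=
  2 * α * ∑ k with 0 < (isHermitian_adjMatrix G).eigenvalues k,
      adjEigenvector G k ⬝ᵥ G.lapMatrix ℝ *ᵥ adjEigenvector G k
    + 2 * ∑ k with (isHermitian_adjMatrix G).eigenvalues k < 0,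
      adjEigenvector G k ⬝ᵥ aAlphaMatrix G α *ᵥ adjEigenvector G k

theorem dotProduct_aAlphaMatrix_mulVec_adjEigenvector (α : ℝ) (k : V) :
    adjEigenvector G k ⬝ᵥ aAlphaMatrix G α *ᵥ adjEigenvector G k
      = (isHermitian_adjMatrix G).eigenvalues k
        + α * (adjEigenvector G k ⬝ᵥ G.lapMatrix ℝ *ᵥ adjEigenvector G k) := by
  rw [aAlphaMatrix_eq_adjMatrix_add_smul_lapMatrix, add_mulVec, smul_mulVec, dotProduct_add,
    dotProduct_smul, smul_eq_mul, (isHermitian_adjMatrix G).eigenvalues_eq]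
  rfl

theorem adjEnergy_eq_sum_pos_sub_sum_neg :
    adjEnergy G = ∑ k with 0 < (isHermitian_adjMatrix G).eigenvalues k,
          (isHermitian_adjMatrix G).eigenvalues k
      - ∑ k with (isHermitian_adjMatrix G).eigenvalues k < 0,
          (isHermitian_adjMatrix G).eigenvalues k := by
  rw [adjEnergy, Finset.sum_filter, Finset.sum_filter, ← Finset.sum_sub_distrib]
  refine Finset.sum_congr rfl fun k _ => ?_
  rcases lt_trichotomy ((isHermitian_adjMatrix G).eigenvalues k) 0 with h | h | h
  · simp [h, h.not_gt, abs_of_neg h]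
  · simp [h]
  · simp [h, h.not_gt, abs_of_pos h]

theorem add_energyGap_le {α : ℝ} (hα : 0 ≤ α) :
    2 * adjEnergy G
        - 4 * α * (G.edgeFinset.card : ℝ) * ((G.adjMatrix ℝ).rank : ℝ) / (Fintype.card V : ℝ)
        + energyGap G α ≤ aAlphaEnergy G α + α * lapEnergy G := by
  have hA := isHermitian_adjMatrix G
  have hpos : 2 * ∑ k with 0 < hA.eigenvalues k,
      (adjEigenvector G k ⬝ᵥ aAlphaMatrix G α *ᵥ adjEigenvector G k
        - 2 * α * (G.edgeFinset.card : ℝ) / (Fintype.card V : ℝ)) ≤ aAlphaEnergy G α :=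
    two_mul_sum_le_aAlphaEnergy G α hA.eigenvectorBasis.orthonormal _
  have hneg : 2 * ∑ k with hA.eigenvalues k < 0,
      (adjEigenvector G k ⬝ᵥ G.lapMatrix ℝ *ᵥ adjEigenvector G k
        - 2 * (G.edgeFinset.card : ℝ) / (Fintype.card V : ℝ)) ≤ lapEnergy G :=
    two_mul_sum_le_lapEnergy G hA.eigenvectorBasis.orthonormal _
  refine le_trans (le_of_eq ?_) (add_le_add hpos (mul_le_mul_of_nonneg_left hneg hα))
  simp only [energyGap, adjEnergy_eq_sum_pos_sub_sum_neg, rank_eq_card_pos_add_card_neg hA,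
    dotProduct_aAlphaMatrix_mulVec_adjEigenvector, Finset.sum_sub_distrib, Finset.sum_add_distrib,
    Finset.sum_const, nsmul_eq_mul, ← Finset.mul_sum, Nat.cast_add]
  ring

variable {G}

theorem energyGap_nonneg {α : ℝ} (hα : 1 / 2 ≤ α) : 0 ≤ energyGap G α :=
  add_nonneg
    (mul_nonneg (by linarith) (Finset.sum_nonneg fun _ _ => dotProduct_lapMatrix_mulVec_nonneg _))
    (mul_nonneg two_pos.le
      (Finset.sum_nonneg fun _ _ => dotProduct_aAlphaMatrix_mulVec_nonneg hα _))

theorem energyGap_eq_zero_iff {α : ℝ} (hα : 1 / 2 ≤ α) :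
    energyGap G α = 0 ↔
      (∀ k, 0 < (isHermitian_adjMatrix G).eigenvalues k →
        ∀ i j, G.Adj i j → adjEigenvector G k i = adjEigenvector G k j) ∧
      ∀ k, (isHermitian_adjMatrix G).eigenvalues k < 0 →
        (∀ i j, G.Adj i j → adjEigenvector G k i = -adjEigenvector G k j) ∧
        (α = 1 / 2 ∨ ∀ i j, G.Adj i j → adjEigenvector G k i = adjEigenvector G k j) := by
  have hL (k : V) := dotProduct_lapMatrix_mulVec_nonneg (G := G) (adjEigenvector G k)
  have hA (k : V) := dotProduct_aAlphaMatrix_mulVec_nonneg (G := G) hα (adjEigenvector G k)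
  have hα0 : 0 < 2 * α := by linarith
  rw [energyGap, add_eq_zero_iff_of_nonneg
      (mul_nonneg hα0.le (Finset.sum_nonneg fun k _ => hL k))
      (mul_nonneg two_pos.le (Finset.sum_nonneg fun k _ => hA k)),
    mul_eq_zero_iff_left hα0.ne', mul_eq_zero_iff_left two_ne_zero,
    Finset.sum_eq_zero_iff_of_nonneg fun k _ => hL k,
    Finset.sum_eq_zero_iff_of_nonneg fun k _ => hA k]
  simp only [Finset.mem_filter_univ, dotProduct_lapMatrix_mulVec_eq_zero_iff,
    dotProduct_aAlphaMatrix_mulVec_eq_zero_iff hα]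

end LowerBound

section Bipartite

variable {V : Type*} {G : SimpleGraph V}

/-- The endpoints of every walk of length three are adjacent. For a connected graph with at least
one edge this says that the graph is complete bipartite. -/
def ThreeWalkClosed (G : SimpleGraph V) : Prop :=
  ∀ ⦃u v w z⦄, G.Adj u v → G.Adj v w → G.Adj w z → G.Adj u z

theorem ThreeWalkClosed.not_adj_of_adj_of_adj (h3 : ThreeWalkClosed G) {u v w : V}
    (huv : G.Adj u v) (hvw : G.Adj v w) : ¬G.Adj u w :=
  fun huw => G.irrefl (h3 huv hvw huw.symm)

theorem ThreeWalkClosed.adj_or_adj (h3 : ThreeWalkClosed G) (hG : G.Preconnected) {x y : V}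
    (hxy : G.Adj x y) (v : V) : G.Adj x v ∨ G.Adj y v := by
  obtain ⟨p⟩ := hG v x
  induction p with
  | nil => exact .inr hxy.symm
  | cons hvw _ ih =>
    rcases ih hxy with h | h
    · exact .inr (h3 hxy.symm h hvw.symm)
    · exact .inl (h3 hxy h hvw.symm)

theorem ThreeWalkClosed.nonempty_iso_completeBipartiteGraph (h3 : ThreeWalkClosed G)
    (hG : G.Preconnected) {x y : V} (hxy : G.Adj x y) :
    Nonempty (G ≃g completeBipartiteGraph (G.neighborSet x) (G.neighborSet y)) := by
  let f : G.neighborSet x ⊕ G.neighborSet y → V := Sum.elim (↑) (↑)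
  have hinj : f.Injective := Subtype.val_injective.sumElim Subtype.val_injective
    fun u v huv => h3.not_adj_of_adj_of_adj hxy v.2 (show G.Adj x v from huv ▸ u.2)
  have hsurj : f.Surjective := fun v =>
    (h3.adj_or_adj hG hxy v).elim (fun h => ⟨.inl ⟨v, h⟩, rfl⟩) (fun h => ⟨.inr ⟨v, h⟩, rfl⟩)
  have hadj : ∀ p q, G.Adj (f p) (f q) ↔ (completeBipartiteGraph _ _).Adj p q := by
    rintro (⟨u, hu⟩ | ⟨u, hu⟩) (⟨v, hv⟩ | ⟨v, hv⟩)
    · simpa [f] using fun h => h3.not_adj_of_adj_of_adj hu h hv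
    · simpa [f] using h3 (SimpleGraph.Adj.symm hu) hxy hv
    · simpa [f] using h3 (SimpleGraph.Adj.symm hu) hxy.symm hv
    · simpa [f] using fun h => h3.not_adj_of_adj_of_adj hu h hv
  exact ⟨RelIso.symm ⟨Equiv.ofBijective f ⟨hinj, hsurj⟩, hadj _ _⟩⟩

theorem ThreeWalkClosed.nonempty_iso_completeBipartiteGraph_fin [Fintype V] [DecidableRel G.Adj]
    [Nontrivial V] (h3 : ThreeWalkClosed G) (hG : G.Connected) {d : ℕ}
    (hd : G.IsRegularOfDegree d) :
    Nonempty (G ≃g completeBipartiteGraph (Fin d) (Fin d)) := by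
  obtain ⟨x⟩ := hG.nonempty
  obtain ⟨y, hxy⟩ := hG.preconnected.exists_adj_of_nontrivial x
  obtain ⟨e⟩ := h3.nonempty_iso_completeBipartiteGraph hG.preconnected hxy
  have hcard (v : V) : G.neighborSet v ≃ Fin d :=
    Fintype.equivFinOfCardEq ((G.card_neighborSet_eq_degree v).trans (hd v))
  exact ⟨e.trans (SimpleGraph.completeBipartiteGraphCongr (hcard x) (hcard y))⟩

theorem threeWalkClosed_of_iso_completeBipartiteGraph {W₁ W₂ : Type*}
    (e : G ≃g completeBipartiteGraph W₁ W₂) : ThreeWalkClosed G := by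
  intro u v w z
  simp only [← e.map_adj_iff, completeBipartiteGraph_adj]
  grind

theorem isRegularOfDegree_completeBipartiteGraph (W : Type*) [Fintype W]
    [(completeBipartiteGraph W W).LocallyFinite] :
    (completeBipartiteGraph W W).IsRegularOfDegree (Fintype.card W) := by
  have hinl (u : W) : (completeBipartiteGraph W W).neighborSet (.inl u) = Set.range .inr := by
    ext (w | w) <;> simp
  have hinr (u : W) : (completeBipartiteGraph W W).neighborSet (.inr u) = Set.range .inl := by
    ext (w | w) <;> simp
  rintro (u | u)
  · rw [← SimpleGraph.card_neighborSet_eq_degree, ← Nat.card_eq_fintype_card, hinl,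
      Nat.card_range_of_injective Sum.inr_injective, Nat.card_eq_fintype_card]
  · rw [← SimpleGraph.card_neighborSet_eq_degree, ← Nat.card_eq_fintype_card, hinr,
      Nat.card_range_of_injective Sum.inl_injective, Nat.card_eq_fintype_card]

theorem isRegularOfDegree_of_iso_completeBipartiteGraph [G.LocallyFinite] {W : Type*} [Fintype W]
    (e : G ≃g completeBipartiteGraph W W) : G.IsRegularOfDegree (Fintype.card W) := by
  classical
  exact fun v => (e.degree_eq v).symm.trans (isRegularOfDegree_completeBipartiteGraph W _)

end Bipartite

section Equality

theorem adjMatrix_ne_zero {V R : Type*} [Nontrivial V] [Zero R] [One R] [NeZero (1 : R)]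
    {G : SimpleGraph V} [DecidableRel G.Adj] (hG : G.Preconnected) : G.adjMatrix R ≠ 0 := by
  intro h
  obtain ⟨x⟩ := Nontrivial.to_nonempty (α := V)
  obtain ⟨y, hxy⟩ := hG.exists_adj_of_nontrivial x
  simpa [hxy] using congrFun₂ h x y

variable {V : Type*} [Fintype V] {G : SimpleGraph V} [DecidableRel G.Adj]

theorem exists_isRegularOfDegree_of_adjMatrix_mulVec_eq_smul (hG : G.Preconnected) {x : V → ℝ}
    (hx : x ≠ 0) (hconst : ∀ i j, G.Adj i j → x i = x j) {c : ℝ}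
    (hc : G.adjMatrix ℝ *ᵥ x = c • x) : ∃ d, G.IsRegularOfDegree d := by
  classical
  have hlap : G.lapMatrix ℝ *ᵥ x = 0 := G.lapMatrix_mulVec_eq_zero_iff_forall_adj.mpr hconst
  have hdeg : G.degMatrix ℝ *ᵥ x = c • x := by
    rwa [SimpleGraph.lapMatrix, sub_mulVec, sub_eq_zero, hc] at hlap
  obtain ⟨v, hv⟩ := Function.ne_iff.mp hx
  have hne (i : V) : x i ≠ 0 :=
    G.lapMatrix_mulVec_eq_zero_iff_forall_reachable.mp hlap i v (hG i v) ▸ hv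
  have hdegree (i : V) : (G.degree i : ℝ) = c :=
    mul_right_cancel₀ (hne i) ((G.degMatrix_mulVec_apply i x).symm.trans (congrFun hdeg i))
  exact ⟨G.degree v, fun i => by exact_mod_cast (hdegree i).trans (hdegree v).symm⟩

theorem two_mul_card_edgeFinset_div_card [Nonempty V] {d : ℕ} (hd : G.IsRegularOfDegree d) :
    2 * (G.edgeFinset.card : ℝ) / (Fintype.card V : ℝ) = d := by
  have hsum : Fintype.card V * d = 2 * G.edgeFinset.card := by
    rw [← G.sum_degrees_eq_twice_card_edges]
    simp only [hd _, Finset.sum_const, Finset.card_univ, smul_eq_mul]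
  rw [div_eq_iff (Nat.cast_ne_zero.mpr Fintype.card_ne_zero), mul_comm (d : ℝ)]
  exact_mod_cast hsum.symm

variable [DecidableEq V]

theorem adjEigenvector_ne_zero (k : V) : adjEigenvector G k ≠ 0 := by
  simpa [adjEigenvector] using (isHermitian_adjMatrix G).eigenvectorBasis.orthonormal.ne_zero k

theorem eq_one_half_of_energyGap_eq_zero [Nontrivial V] (hG : G.Preconnected) {α : ℝ}
    (hα : 1 / 2 ≤ α) (hgap : energyGap G α = 0) : α = 1 / 2 := by
  obtain ⟨k, hk⟩ := exists_eigenvalues_neg (isHermitian_adjMatrix G)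
    (G.trace_adjMatrix ℝ) (adjMatrix_ne_zero hG)
  obtain ⟨halt, hhalf | hconst⟩ := ((energyGap_eq_zero_iff hα).mp hgap).2 k hk
  · exact hhalf
  · refine absurd (funext fun i => ?_) (adjEigenvector_ne_zero (G := G) k)
    obtain ⟨j, hij⟩ := hG.exists_adj_of_nontrivial i
    exact self_eq_neg.mp ((halt i j hij).trans (congrArg _ (hconst i j hij).symm))

theorem exists_isRegularOfDegree_of_energyGap_eq_zero [Nontrivial V] (hG : G.Preconnected) {α : ℝ}
    (hα : 1 / 2 ≤ α) (hgap : energyGap G α = 0) : ∃ d, G.IsRegularOfDegree d := by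
  obtain ⟨k, hk⟩ := exists_eigenvalues_pos (isHermitian_adjMatrix G)
    (G.trace_adjMatrix ℝ) (adjMatrix_ne_zero hG)
  exact exists_isRegularOfDegree_of_adjMatrix_mulVec_eq_smul hG (adjEigenvector_ne_zero k)
    (((energyGap_eq_zero_iff hα).mp hgap).1 k hk)
    ((isHermitian_adjMatrix G).mulVec_eigenvectorBasis k)

theorem threeWalkClosed_of_energyGap_eq_zero {α : ℝ} (hα : 1 / 2 ≤ α)
    (hgap : energyGap G α = 0) : ThreeWalkClosed G := by
  obtain ⟨hpos, hneg⟩ := (energyGap_eq_zero_iff hα).mp hgap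
  intro u v w z huv hvw hwz
  have hrow : G.adjMatrix ℝ u = G.adjMatrix ℝ w := by
    refine row_eq_row_of_eigenvector_apply_eq (isHermitian_adjMatrix G) fun k hk => ?_
    rcases hk.lt_or_gt with hk | hk
    · exact ((hneg k hk).1 u v huv).trans ((hneg k hk).1 w v hvw.symm).symm
    · exact (hpos k hk u v huv).trans (hpos k hk v w hvw)
  simpa [hwz] using congrFun hrow z

theorem degMatrix_eq_smul_one {R : Type*} [NonAssocSemiring R] {d : ℕ}
    (hd : G.IsRegularOfDegree d) : G.degMatrix R = (d : R) • 1 := by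
  simp only [SimpleGraph.degMatrix, hd _, smul_one_eq_diagonal]

theorem lapEnergy_eq_adjEnergy [Nonempty V] {d : ℕ} (hd : G.IsRegularOfDegree d) :
    lapEnergy G = adjEnergy G := by
  have hlap : G.lapMatrix ℝ = (d : ℝ) • 1 + (-1 : ℝ) • G.adjMatrix ℝ := by
    rw [SimpleGraph.lapMatrix, degMatrix_eq_smul_one hd]
    module
  rw [lapEnergy, two_mul_card_edgeFinset_div_card hd,
    sum_abs_eigenvalues_sub_of_eq_smul_one_add_smul (isHermitian_adjMatrix G)
      (isHermitian_lapMatrix G) hlap, abs_neg, abs_one, one_mul, adjEnergy]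

theorem aAlphaEnergy_eq_abs_mul_adjEnergy [Nonempty V] {d : ℕ} (hd : G.IsRegularOfDegree d)
    (α : ℝ) : aAlphaEnergy G α = |1 - α| * adjEnergy G := by
  have haAlpha : aAlphaMatrix G α = (α * d) • 1 + (1 - α) • G.adjMatrix ℝ := by
    rw [aAlphaMatrix, degMatrix_eq_smul_one hd, smul_smul]
  have hcenter : 2 * α * (G.edgeFinset.card : ℝ) / (Fintype.card V : ℝ) = α * d := by
    rw [← two_mul_card_edgeFinset_div_card hd]
    ring
  rw [aAlphaEnergy, hcenter, sum_abs_eigenvalues_sub_of_eq_smul_one_add_smul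
    (isHermitian_adjMatrix G) (isHermitian_aAlphaMatrix G α) haAlpha, adjEnergy]

theorem ThreeWalkClosed.adjMatrix_pow_three {R : Type*} [Semiring R]
    (h3 : ThreeWalkClosed G) {d : ℕ} (hd : G.IsRegularOfDegree d) :
    G.adjMatrix R ^ 3 = (d : R) ^ 2 • G.adjMatrix R := by
  ext u z
  have hentry : ∀ v ∈ G.neighborFinset u, ∀ w ∈ G.neighborFinset v,
      G.adjMatrix R w z = G.adjMatrix R u z := by
    intro v huv w hvw
    rw [SimpleGraph.mem_neighborFinset] at huv hvw
    have hadj : G.Adj w z ↔ G.Adj u z := ⟨h3 huv hvw, h3 hvw.symm huv.symm⟩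
    simp only [SimpleGraph.adjMatrix_apply, hadj]
  calc (G.adjMatrix R ^ 3) u z
      = ∑ v ∈ G.neighborFinset u, ∑ w ∈ G.neighborFinset v, G.adjMatrix R w z := by
        simp only [pow_succ', pow_zero, mul_one, SimpleGraph.adjMatrix_mul_apply]
    _ = ∑ v ∈ G.neighborFinset u, ∑ _w ∈ G.neighborFinset v, G.adjMatrix R u z :=
        Finset.sum_congr rfl fun v hv => Finset.sum_congr rfl (hentry v hv)
    _ = ((d : R) ^ 2 • G.adjMatrix R) u z := by
        simp only [Finset.sum_const, SimpleGraph.card_neighborFinset_eq_degree, hd _, nsmul_eq_mul,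
          Matrix.smul_apply, smul_eq_mul, sq, mul_assoc]

theorem ThreeWalkClosed.adjEnergy_eq_mul_rank (h3 : ThreeWalkClosed G) {d : ℕ}
    (hd : G.IsRegularOfDegree d) : adjEnergy G = d * (G.adjMatrix ℝ).rank :=
  sum_abs_eigenvalues_eq_mul_rank _ d.cast_nonneg (h3.adjMatrix_pow_three hd)

theorem ThreeWalkClosed.aAlphaEnergy_add_lapEnergy_eq [Nonempty V] (h3 : ThreeWalkClosed G)
    {d : ℕ} (hd : G.IsRegularOfDegree d) :
    aAlphaEnergy G (1 / 2) + 1 / 2 * lapEnergy G = 2 * adjEnergy G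
      - 4 * (1 / 2) * (G.edgeFinset.card : ℝ) * ((G.adjMatrix ℝ).rank : ℝ)
          / (Fintype.card V : ℝ) := by
  have hsub : 4 * (1 / 2) * (G.edgeFinset.card : ℝ) * ((G.adjMatrix ℝ).rank : ℝ)
      / (Fintype.card V : ℝ) = adjEnergy G := by
    rw [h3.adjEnergy_eq_mul_rank hd, ← two_mul_card_edgeFinset_div_card hd]
    ring
  rw [hsub, aAlphaEnergy_eq_abs_mul_adjEnergy hd, lapEnergy_eq_adjEnergy hd,
    abs_of_nonneg (by norm_num : (0 : ℝ) ≤ 1 - 1 / 2)]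
  ring

end Equality

end GraphEnergy

open GraphEnergy in
theorem theorem5p1_general {V : Type*} [Fintype V] [DecidableEq V] (G : SimpleGraph V)
    [DecidableRel G.Adj] (hG : G.Connected) (hn : 2 ≤ Fintype.card V)
    (α : ℝ) (hα : 1 / 2 ≤ α) :
    aAlphaEnergy G α + α * lapEnergy G ≥
        2 * adjEnergy G
          - 4 * α * (G.edgeFinset.card : ℝ) * ((G.adjMatrix ℝ).rank : ℝ)
              / (Fintype.card V : ℝ) ∧
      (aAlphaEnergy G α + α * lapEnergy G =
          2 * adjEnergy G
            - 4 * α * (G.edgeFinset.card : ℝ) * ((G.adjMatrix ℝ).rank : ℝ)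
                / (Fintype.card V : ℝ) ↔
        α = 1 / 2 ∧ ∃ k : ℕ, Fintype.card V = 2 * k ∧
          Nonempty (G ≃g completeBipartiteGraph (Fin k) (Fin k))) := by
  have : Nontrivial V := Fintype.one_lt_card_iff_nontrivial.mp hn
  have hbound := add_energyGap_le G (by linarith : 0 ≤ α)
  have hnonneg : 0 ≤ energyGap G α := energyGap_nonneg hα
  refine ⟨by linarith, fun heq => ?_, ?_⟩
  · have hgap : energyGap G α = 0 := by linarith
    obtain ⟨d, hd⟩ := exists_isRegularOfDegree_of_energyGap_eq_zero hG.preconnected hα hgap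
    obtain ⟨e⟩ :=
      (threeWalkClosed_of_energyGap_eq_zero hα hgap).nonempty_iso_completeBipartiteGraph_fin hG hd
    have hcard : Fintype.card V = 2 * d := by simp [Fintype.card_congr e.toEquiv, two_mul]
    exact ⟨eq_one_half_of_energyGap_eq_zero hG.preconnected hα hgap, d, hcard, ⟨e⟩⟩
  · rintro ⟨rfl, k, -, ⟨e⟩⟩
    exact (threeWalkClosed_of_iso_completeBipartiteGraph e).aAlphaEnergy_add_lapEnergy_eq
      (isRegularOfDegree_of_iso_completeBipartiteGraph e)

theorem theorem5p1 {V : Type*} [Fintype V] [DecidableEq V] (G : SimpleGraph V)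
    [DecidableRel G.Adj] (hG : G.Connected) (hn : 2 ≤ Fintype.card V)
    (α : ℝ) (hα : 1 / 2 ≤ α) (hα' : α < 1) :
    GraphEnergy.aAlphaEnergy G α + α * GraphEnergy.lapEnergy G ≥
        2 * GraphEnergy.adjEnergy G
          - 4 * α * (G.edgeFinset.card : ℝ) * ((G.adjMatrix ℝ).rank : ℝ)
              / (Fintype.card V : ℝ) ∧
      (GraphEnergy.aAlphaEnergy G α + α * GraphEnergy.lapEnergy G =
          2 * GraphEnergy.adjEnergy G
            - 4 * α * (G.edgeFinset.card : ℝ) * ((G.adjMatrix ℝ).rank : ℝ)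
                / (Fintype.card V : ℝ) ↔
        α = 1 / 2 ∧ ∃ k : ℕ, Fintype.card V = 2 * k ∧
          Nonempty (G ≃g completeBipartiteGraph (Fin k) (Fin k))) :=
  theorem5p1_general G hG hn α hα
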